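/- Let $D\subset\mathbb{C}$ be a bounded domain with $C^1$ boundary, let $u\ge 0$ be a real function that is $C^\infty$ in a neighborhood of $\overline D$, and let $f:\partial D\to\mathbb{R}$ be a bounded Borel function. For $z\in D$ let $g_z$ be the Green function of the Laplacian on $D$ with singularity at $z$, that is, $\Delta g_z=\delta_z$ in $D$ (in the sense of distributions), with $g_z$ continuous on $\overline D\setminus\{z\}$ and $g_z=0$ on $\partial D$. Let $\phi_0$ be the Perron solution of the Dirichlet problem $\Delta\phi_0=0$ in $D$, $\phi_0=f$ on $\partial D$, that is, $\phi_0(\xi)=\sup_v v(\xi)$ over all continuous subharmonic functions $v$ on $D$ with $\limsup_{\xi\to\zeta}v(\xi)\le f(\zeta)$ for every $\zeta\in\partial D$. For the solution $\phi_\epsilon$ of $(\Delta-\epsilon u)\phi_\epsilon=0$ in $D$, $\phi_\epsilon=f$ on $\partial D$, the linearization (the coefficient of $\epsilon$ in the expansion of $\phi_\epsilon$ as $\epsilon\to0$) is $$\delta\phi_\epsilon(z)=\int_D u\,\phi_0\,g_z\,dA ,$$ and this formula is taken here as the definition of $\delta\phi_\epsilon(z)$. Then, for every $z\in D$, $u$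 and $g_z$ belong to $L^2(D)$, the integral converges absolutely, and $$|\delta\phi_\epsilon(z)|\le \|u\|_2\,\|g_z\|_2\,\|f\|_\infty ,$$ where $\|\cdot\|_2$ is the norm of $L^2(D,dA)$ and $\|f\|_\infty=\sup_{\partial D}|f|$. -/

import Mathlib

open MeasureTheory Set Filter Topology
open scoped ContDiff Laplacian

/-- A bounded planar domain with `C¹` boundary: a nonempty, connected, bounded open set which near
each of its boundary points is the sublevel set `{ρ < 0}` of a `C¹` function `ρ` whose
differential does not vanish at that point. -/
structure IsBoundedC1Domain (D : Set ℂ) : Prop where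
  isOpen : IsOpen D
  isConnected : IsConnected D
  isBounded : Bornology.IsBounded D
  c1_boundary : ∀ ζ ∈ frontier D, ∃ ρ : ℂ → ℝ, ContDiffAt ℝ 1 ρ ζ ∧ fderiv ℝ ρ ζ ≠ 0 ∧
    ∀ᶠ ξ in 𝓝 ζ, (ξ ∈ D ↔ ρ ξ < 0)

/-- `u ∈ C^∞(closure D)`: `u` is smooth in a neighborhood of the closure of `D`. -/
def IsSmoothOnClosure (D : Set ℂ) (u : ℂ → ℝ) : Prop :=
  ∃ U : Set ℂ, IsOpen U ∧ closure D ⊆ U ∧ ContDiffOn ℝ ∞ u U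

/-- `g` is the Green function of the Laplacian on `D` with singularity at `w`: it solves
`Δ g = δ_w` in `D` in the sense of distributions, is continuous up to the boundary away from `w`,
and vanishes on the boundary. -/
structure IsGreenFunction (D : Set ℂ) (w : ℂ) (g : ℂ → ℝ) : Prop where
  continuousOn : ContinuousOn g (closure D \ {w})
  locallyIntegrable : LocallyIntegrableOn g D
  laplacian_eq : ∀ ψ : ℂ → ℝ, ContDiff ℝ ∞ ψ → HasCompactSupport ψ → tsupport ψ ⊆ D →
    ∫ ξ in D, g ξ * (Δ ψ) ξ = ψ w
  boundary : ∀ ζ ∈ frontier D, g ζ = 0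

/-- A continuous function `v` is subharmonic on the open set `D` if its value at the center of any
closed disk contained in `D` is at most its average over the bounding circle. -/
structure IsSubharmonicOn (D : Set ℂ) (v : ℂ → ℝ) : Prop where
  continuousOn : ContinuousOn v D
  le_circleAverage : ∀ c : ℂ, ∀ r : ℝ, 0 < r → Metric.closedBall c r ⊆ D →
    v c ≤ Real.circleAverage v c r

/-- The Perron class of the boundary function `f`: the subharmonic functions `v` on `D` with
`limsup_{ξ → ζ} v ξ ≤ f ζ` at every boundary point `ζ`. -/
structure IsPerronSubfunction (D : Set ℂ) (f : frontier D → ℝ) (v : ℂ → ℝ) : Prop where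
  subharmonic : IsSubharmonicOn D v
  limsup_le : ∀ ζ : frontier D, ∀ b : ℝ, f ζ < b → ∀ᶠ ξ in 𝓝[D] (ζ : ℂ), v ξ < b

/-- The (generalized, Perron) solution `φ₀` of the Dirichlet problem `Δ φ₀ = 0` in `D`, `φ₀ = f`
on the boundary: the upper envelope of the Perron class of `f`. For bounded Borel `f` it is the
Poisson integral of `f`, that is, the integral of `f` against harmonic measure. -/
noncomputable def dirichletSolution (D : Set ℂ) (f : frontier D → ℝ) (ξ : ℂ) : ℝ :=
  sSup {t : ℝ | ∃ v : ℂ → ℝ, IsPerronSubfunction D f v ∧ v ξ = t}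

/-- The coefficient of `ε` in the expansion of the solution `φ_ε` of `(Δ - ε u) φ_ε = 0` in `D`,
`φ_ε = f` on the boundary, at the point at which the Green function `g` has its singularity. -/
noncomputable def firstOrderTerm (D : Set ℂ) (u : ℂ → ℝ) (f : frontier D → ℝ) (g : ℂ → ℝ) : ℝ :=
  ∫ ξ in D, u ξ * dirichletSolution D f ξ * g ξ

/-- The norm of `L²(D)` with respect to area measure. -/
noncomputable def l2Norm (D : Set ℂ) (h : ℂ → ℝ) : ℝ := lpNorm h 2 (volume.restrict D)

/-- The sup norm of a bounded function on the boundary of `D`. -/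
noncomputable def boundarySupNorm (D : Set ℂ) (f : frontier D → ℝ) : ℝ := ⨆ ζ, |f ζ|

/-!
By the maximum principle `|φ₀| ≤ ‖f‖_∞`, and `φ₀` is measurable because a supremum of continuous
functions is lower semicontinuous. The Green function has at most a logarithmic singularity at `z`.
Indeed, let `ψ` be `ξ ↦ log (‖ξ - w‖² + s)` cut off smoothly inside `D`. Its Laplacian is `4π` times
an approximate identity at `w` up to an error that is bounded uniformly in `w` and `s`, so testing
`Δ g = δ_z` against `ψ` and letting `s → 0⁺` gives `4π |g w| ≤ |log (‖w - z‖²)| + C`. Hence `g` is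
in `Lᵖ(D)` for every `p < ∞`, and the estimate is Hölder's inequality.
-/

theorem isCompact_inter_preimage_of_eventually_notMem {X Y : Type*} [TopologicalSpace X]
    [TopologicalSpace Y] {D : Set X} (hD : IsOpen D) (hK : IsCompact (closure D)) {f : X → Y}
    (hf : ContinuousOn f D) {S : Set Y} (hS : IsClosed S)
    (hfS : ∀ ζ ∈ frontier D, ∀ᶠ ξ in 𝓝[D] ζ, f ξ ∉ S) : IsCompact (D ∩ f ⁻¹' S) := by
  refine hK.of_isClosed_subset (isClosed_of_closure_subset fun y hy => ?_)
    (inter_subset_left.trans subset_closure)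
  have hyD : y ∈ D := by
    by_contra hyD
    have hyf : y ∈ frontier D := ⟨closure_mono inter_subset_left hy, by rwa [hD.interior_eq]⟩
    obtain ⟨p, ⟨hpD, hpS⟩, hp⟩ := ((mem_closure_iff_frequently.1 hy).and_eventually
      (eventually_nhdsWithin_iff.1 (hfS y hyf))).exists
    exact hp hpD hpS
  exact ⟨hyD, hS.closure_subset_iff.2 (image_subset_iff.2 inter_subset_right)
    (((hf y hyD).mono inter_subset_left).mem_closure_image hy)⟩

theorem circleAverage_lt_of_le_of_exists_lt {v : ℂ → ℝ} {c : ℂ} {r M : ℝ}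
    (hv : ContinuousOn v (Metric.sphere c |r|)) (hle : ∀ ξ ∈ Metric.sphere c |r|, v ξ ≤ M)
    (hlt : ∃ ξ ∈ Metric.sphere c |r|, v ξ < M) : Real.circleAverage v c r < M := by
  have hmem : ∀ θ, circleMap c r θ ∈ Metric.sphere c |r| := circleMap_mem_sphere' c r
  obtain ⟨ξ, hξ, hξM⟩ := hlt
  rw [← image_circleMap_Ioc] at hξ
  obtain ⟨θ, hθ, rfl⟩ := hξ
  have hint : ∫ θ in (0 : ℝ)..2 * Real.pi, v (circleMap c r θ) < ∫ _ in (0 : ℝ)..2 * Real.pi, M :=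
    intervalIntegral.integral_lt_integral_of_continuousOn_of_le_of_exists_lt Real.two_pi_pos
      (hv.comp (continuous_circleMap c r).continuousOn fun θ _ => hmem θ) continuousOn_const
      (fun θ _ => hle _ (hmem θ)) ⟨θ, Ioc_subset_Icc_self hθ, hξM⟩
  rwa [intervalIntegral.integral_const, sub_zero, smul_eq_mul,
    ← inv_mul_lt_iff₀ Real.two_pi_pos] at hint

namespace IsSubharmonicOn

variable {D : Set ℂ} {v : ℂ → ℝ}

theorem eq_of_isMaxOn (hv : IsSubharmonicOn D v) {q : ℂ} (hq : IsMaxOn v D q) {r : ℝ}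
    (hr : 0 < r) (hrD : Metric.closedBall q r ⊆ D) {ξ : ℂ} (hξ : ξ ∈ Metric.sphere q r) :
    v ξ = v q := by
  rw [← abs_of_pos hr] at hξ
  have hsD : Metric.sphere q |r| ⊆ D := by
    rw [abs_of_pos hr]
    exact Metric.sphere_subset_closedBall.trans hrD
  by_contra hne
  exact (circleAverage_lt_of_le_of_exists_lt (hv.continuousOn.mono hsD)
    (fun η hη => hq (hsD hη)) ⟨ξ, hξ, (hq (hsD hξ)).lt_of_ne hne⟩).not_ge
    (hv.le_circleAverage q r hr hrD)

theorem le_of_eventually_lt_frontier (hv : IsSubharmonicOn D v) (hDo : IsOpen D)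
    (hDb : Bornology.IsBounded D) {M : ℝ}
    (hM : ∀ ζ ∈ frontier D, ∀ b, M < b → ∀ᶠ ξ in 𝓝[D] ζ, v ξ < b) {x : ℂ} (hx : x ∈ D) :
    v x ≤ M := by
  by_contra! hMx
  obtain ⟨b, hMb, hbx⟩ := exists_between hMx
  have hcompact : ∀ S ⊆ Ici b, IsClosed S → IsCompact (D ∩ v ⁻¹' S) := fun S hSb hS =>
    isCompact_inter_preimage_of_eventually_notMem hDo hDb.isCompact_closure hv.continuousOn hS
      fun ζ hζ => (hM ζ hζ b hMb).mono fun _ hξ hξS => hξ.not_ge (hSb hξS)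
  obtain ⟨p, ⟨hpD, hpb⟩, hp⟩ := (hcompact (Ici b) subset_rfl isClosed_Ici).exists_isMaxOn
    ⟨x, hx, hbx.le⟩ (hv.continuousOn.mono inter_subset_left)
  have hpmax : IsMaxOn v D p := fun y hy =>
    (le_total b (v y)).elim (fun hyb => hp ⟨hy, hyb⟩) fun hyb => hyb.trans hpb
  -- A maximum point with the largest real part cannot be the center of a disk in `D`.
  obtain ⟨q, ⟨hqD, hqp⟩, hq⟩ := (hcompact {v p} (singleton_subset_iff.2 hpb)
    isClosed_singleton).exists_isMaxOn ⟨p, hpD, rfl⟩ Complex.continuous_re.continuousOn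
  obtain ⟨r, hr, hrD⟩ := Metric.nhds_basis_closedBall.mem_iff.1 (hDo.mem_nhds hqD)
  have hqr : q + r ∈ Metric.sphere q r := by simp [hr.le]
  have hvqr : v (q + r) = v q :=
    hv.eq_of_isMaxOn (fun y hy => (hpmax hy).trans_eq hqp.symm) hr hrD hqr
  have hre : (q + r).re ≤ q.re :=
    hq ⟨hrD (Metric.sphere_subset_closedBall hqr), hvqr.trans hqp⟩
  rw [Complex.add_re, Complex.ofReal_re] at hre
  linarith

end IsSubharmonicOn

theorem isPerronSubfunction_const {D : Set ℂ} {f : frontier D → ℝ} {m : ℝ} (hm : ∀ ζ, m ≤ f ζ) :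
    IsPerronSubfunction D f fun _ => m where
  subharmonic := ⟨continuousOn_const, fun c r _ _ => (Real.circleAverage_const m c r).ge⟩
  limsup_le ζ _ hb := .of_forall fun _ => (hm ζ).trans_lt hb

theorem IsPerronSubfunction.le {D : Set ℂ} {f : frontier D → ℝ} {v : ℂ → ℝ}
    (hv : IsPerronSubfunction D f v) (hDo : IsOpen D) (hDb : Bornology.IsBounded D) {M : ℝ}
    (hM : ∀ ζ, f ζ ≤ M) {x : ℂ} (hx : x ∈ D) : v x ≤ M :=
  hv.subharmonic.le_of_eventually_lt_frontier hDo hDb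
    (fun ζ hζ b hMb => hv.limsup_le ⟨ζ, hζ⟩ b ((hM _).trans_lt hMb)) hx

theorem dirichletSolution_eq_iSup (D : Set ℂ) (f : frontier D → ℝ) (ξ : ℂ) :
    dirichletSolution D f ξ = ⨆ v : {v : ℂ → ℝ // IsPerronSubfunction D f v}, v.1 ξ := by
  rw [dirichletSolution, iSup]
  congr
  ext t
  simp

theorem aemeasurable_restrict_of_lowerSemicontinuousOn {X R : Type*} [TopologicalSpace X]
    [MeasurableSpace X] [OpensMeasurableSpace X] [TopologicalSpace R] [MeasurableSpace R]
    [BorelSpace R] [LinearOrder R] [OrderTopology R] [SecondCountableTopology R] {μ : Measure X}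
    {s : Set X} (hs : MeasurableSet s) {f : X → R} (hf : LowerSemicontinuousOn f s) :
    AEMeasurable f (μ.restrict s) :=
  aemeasurable_restrict_of_measurable_subtype hs
    (lowerSemicontinuous_restrict_iff.2 hf).measurable

section DirichletSolution

variable {D : Set ℂ} {f : frontier D → ℝ}

theorem bddAbove_range_isPerronSubfunction (hDo : IsOpen D) (hDb : Bornology.IsBounded D)
    (hf : BddAbove (range f)) {x : ℂ} (hx : x ∈ D) :
    BddAbove (range fun v : {v : ℂ → ℝ // IsPerronSubfunction D f v} => v.1 x) := by
  obtain ⟨M, hM⟩ := hf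
  exact ⟨M, forall_mem_range.2 fun v => v.2.le hDo hDb (forall_mem_range.1 hM) hx⟩

theorem abs_dirichletSolution_le (hDo : IsOpen D) (hDb : Bornology.IsBounded D) {M : ℝ}
    (hM : ∀ ζ, |f ζ| ≤ M) {x : ℂ} (hx : x ∈ D) : |dirichletSolution D f x| ≤ M := by
  have hconst : IsPerronSubfunction D f fun _ => -M :=
    isPerronSubfunction_const fun ζ => (abs_le.1 (hM ζ)).1
  have hfM : ∀ ζ, f ζ ≤ M := fun ζ => (abs_le.1 (hM ζ)).2
  have : Nonempty {v : ℂ → ℝ // IsPerronSubfunction D f v} := ⟨⟨_, hconst⟩⟩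
  rw [dirichletSolution_eq_iSup]
  exact abs_le.2 ⟨le_ciSup (bddAbove_range_isPerronSubfunction hDo hDb
    ⟨M, forall_mem_range.2 hfM⟩ hx) ⟨_, hconst⟩, ciSup_le fun v => v.2.le hDo hDb hfM hx⟩

theorem lowerSemicontinuousOn_dirichletSolution (hDo : IsOpen D) (hDb : Bornology.IsBounded D)
    (hf : BddAbove (range f)) : LowerSemicontinuousOn (dirichletSolution D f) D := by
  rw [funext (dirichletSolution_eq_iSup D f)]
  exact lowerSemicontinuousOn_ciSup
    (fun x hx => bddAbove_range_isPerronSubfunction hDo hDb hf hx)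
    fun v => v.2.subharmonic.continuousOn.lowerSemicontinuousOn

end DirichletSolution

section Integration

variable {α : Type*} [MeasurableSpace α] {μ : Measure α}

theorem lpNorm_mul_le_lpNorm_mul_lpNorm {A : Type*} [NormedRing A] {p q r : ENNReal}
    [p.HolderTriple q r] {u v : α → A} (hu : MemLp u p μ) (hv : MemLp v q μ) :
    lpNorm (u * v) r μ ≤ lpNorm u p μ * lpNorm v q μ := by
  rw [← toReal_eLpNorm (hv.mul hu : MemLp (u * v) r μ).1, ← toReal_eLpNorm hu.1,
    ← toReal_eLpNorm hv.1, ← ENNReal.toReal_mul]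
  exact ENNReal.toReal_mono (ENNReal.mul_ne_top hu.2.ne hv.2.ne)
    (eLpNorm_smul_le_mul_eLpNorm (φ := u) (f := v) hv.1 hu.1)

theorem integrable_mul_mul_of_bound {p q : ENNReal} [p.HolderConjugate q] {u φ g : α → ℝ}
    (hu : MemLp u p μ) (hφ : AEStronglyMeasurable φ μ) {M : ℝ} (hM : ∀ᵐ x ∂μ, |φ x| ≤ M)
    (hg : MemLp g q μ) : Integrable (fun x => u x * φ x * g x) μ := by
  have hug : Integrable (fun x => u x * g x) μ := memLp_one_iff_integrable.1 (hg.mul hu)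
  simpa only [mul_left_comm, mul_assoc] using hug.bdd_mul hφ hM

theorem abs_integral_mul_mul_le_of_bound {p q : ENNReal} [p.HolderConjugate q] {u φ g : α → ℝ}
    (hu : MemLp u p μ) {M : ℝ} (hM0 : 0 ≤ M) (hM : ∀ᵐ x ∂μ, |φ x| ≤ M) (hg : MemLp g q μ) :
    |∫ x, u x * φ x * g x ∂μ| ≤ lpNorm u p μ * lpNorm g q μ * M := by
  have hug : MemLp (u * g) 1 μ := hg.mul hu
  calc |∫ x, u x * φ x * g x ∂μ| ≤ ∫ x, ‖u x * g x‖ * M ∂μ := by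
        refine norm_integral_le_of_norm_le (G := ℝ)
          ((memLp_one_iff_integrable.1 hug).norm.mul_const M) ?_
        filter_upwards [hM] with x hx
        rw [mul_right_comm, norm_mul _ (φ x), Real.norm_eq_abs (φ x)]
        gcongr
    _ = lpNorm (u * g) 1 μ * M := by
        rw [integral_mul_const, lpNorm_one_eq_integral_norm hug.1]
        simp only [Pi.mul_apply]
    _ ≤ lpNorm u p μ * lpNorm g q μ * M :=
        mul_le_mul_of_nonneg_right (lpNorm_mul_le_lpNorm_mul_lpNorm hu hg) hM0

theorem abs_integral_mul_le_abs_integral_mul_add {a b g : α → ℝ} (ha : AEStronglyMeasurable a μ)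
    (hb : AEStronglyMeasurable b μ) (hg : Integrable g μ)
    (hbg : Integrable (fun x => b x * g x) μ) {M : ℝ} (hM : ∀ᵐ x ∂μ, |a x - b x| ≤ M) :
    |∫ x, a x * g x ∂μ| ≤ |∫ x, b x * g x ∂μ| + M * ∫ x, |g x| ∂μ := by
  have hsub : Integrable (fun x => (a x - b x) * g x) μ := hg.bdd_mul (ha.sub hb) hM
  have hbound : |∫ x, (a x - b x) * g x ∂μ| ≤ M * ∫ x, |g x| ∂μ := by
    rw [← integral_const_mul]
    refine norm_integral_le_of_norm_le (G := ℝ) (hg.abs.const_mul M) ?_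
    filter_upwards [hM] with x hx
    rw [norm_mul, Real.norm_eq_abs, Real.norm_eq_abs]
    gcongr
  have hsplit : ∫ x, a x * g x ∂μ = ∫ x, b x * g x ∂μ + ∫ x, (a x - b x) * g x ∂μ := by
    rw [← integral_add hbg hsub]
    exact integral_congr_ae (.of_forall fun x => by ring)
  rw [hsplit]
  exact (abs_add_le _ _).trans (add_le_add_right hbound _)

theorem memLp_restrict_union {E : Type*} [NormedAddCommGroup E] {f : α → E} {p : ENNReal}
    {s t : Set α} (hs : MeasurableSet s) (ht : MeasurableSet t) (hfs : MemLp f p (μ.restrict s))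
    (hft : MemLp f p (μ.restrict t)) : MemLp f p (μ.restrict (s ∪ t)) := by
  have hft' : MemLp f p (μ.restrict (t \ s)) :=
    hft.mono_measure (Measure.restrict_mono sdiff_subset le_rfl)
  rw [← memLp_indicator_iff_restrict hs] at hfs
  rw [← memLp_indicator_iff_restrict (ht.diff hs)] at hft'
  rw [← memLp_indicator_iff_restrict (hs.union ht), ← union_sdiff_self,
    indicator_union_of_disjoint disjoint_sdiff_right]
  exact hfs.add hft'

theorem memLp_restrict_of_continuousOn {X E : Type*} [TopologicalSpace X] [MeasurableSpace X]
    [OpensMeasurableSpace X] {μ : Measure X} [IsFiniteMeasureOnCompacts μ] [NormedAddCommGroup E]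
    [SecondCountableTopologyEither X E] {f : X → E} {s K : Set X} (hs : MeasurableSet s)
    (hK : IsCompact K) (hsK : s ⊆ K) (hf : ContinuousOn f K) {p : ENNReal} :
    MemLp f p (μ.restrict s) := by
  obtain ⟨C, hC⟩ := hK.exists_bound_of_continuousOn hf
  have : IsFiniteMeasure (μ.restrict s) :=
    isFiniteMeasure_restrict.2 ((measure_mono hsK).trans_lt hK.measure_lt_top).ne
  exact MemLp.of_bound ((hf.mono hsK).aestronglyMeasurable hs) C
    (ae_restrict_of_forall_mem hs fun x hx => hC x (hsK hx))

end Integration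

theorem abs_log_le_rpow_add_rpow_neg_div {y δ : ℝ} (hy : 0 ≤ y) (hδ : 0 < δ) :
    |Real.log y| ≤ (y ^ δ + y ^ (-δ)) / δ := by
  have hlog : Real.log y ≤ y ^ δ / δ := Real.log_le_rpow_div hy hδ
  have hinv : -Real.log y ≤ y ^ (-δ) / δ := by
    rw [← Real.log_inv, Real.rpow_neg_eq_inv_rpow]
    exact Real.log_le_rpow_div (inv_nonneg.2 hy) hδ
  rw [add_div, abs_le]
  have h₁ : 0 ≤ y ^ δ / δ := by positivity
  have h₂ : 0 ≤ y ^ (-δ) / δ := by positivity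
  constructor <;> linarith

theorem exists_abs_log_le_mul_rpow_neg {δ : ℝ} (hδ : 0 < δ) (r : ℝ) :
    ∃ C, 0 ≤ C ∧ ∀ y, 0 < y → y ≤ r → |Real.log y| ≤ C * y ^ (-δ) := by
  refine ⟨(|r| ^ (2 * δ) + 1) / δ, by positivity, fun y hy hyr => ?_⟩
  have hpow : y ^ δ = y ^ (2 * δ) * y ^ (-δ) := by
    rw [← Real.rpow_add hy]
    ring_nf
  calc |Real.log y| ≤ (y ^ δ + y ^ (-δ)) / δ := abs_log_le_rpow_add_rpow_neg_div hy.le hδ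
    _ = (y ^ (2 * δ) + 1) / δ * y ^ (-δ) := by
        rw [hpow]
        ring
    _ ≤ (|r| ^ (2 * δ) + 1) / δ * y ^ (-δ) := by
        gcongr
        exact hyr.trans (le_abs_self r)

theorem memLp_log_norm_sub {E : Type*} [NormedAddCommGroup E] [NormedSpace ℝ E]
    [FiniteDimensional ℝ E] [Nontrivial E] [MeasurableSpace E] [BorelSpace E] (μ : Measure E)
    [μ.IsAddHaarMeasure] (z : E) (r : ℝ) {p : ENNReal} (hp : p ≠ ⊤) :
    MemLp (fun x => Real.log ‖x - z‖) p (μ.restrict (Metric.ball z r)) := by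
  have hmeas : Measurable fun x : E => Real.log ‖x‖ := by fun_prop
  have hshift : MeasurePreserving (fun x => x - z) (μ.restrict (Metric.ball z r))
      (μ.restrict (Metric.ball 0 r)) := by
    convert (measurePreserving_sub_right μ z).restrict_preimage
      (Metric.isOpen_ball (x := (0 : E)) (ε := r)).measurableSet using 2
    ext x
    simp [dist_eq_norm]
  suffices MemLp (fun x => Real.log ‖x‖) p (μ.restrict (Metric.ball 0 r)) from
    this.comp_measurePreserving hshift
  rcases eq_or_ne p 0 with rfl | hp0
  · exact memLp_zero_iff_aestronglyMeasurable.2 hmeas.aestronglyMeasurable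
  have hq : 0 < p.toReal := ENNReal.toReal_pos hp0 hp
  obtain ⟨C, hC0, hC⟩ := exists_abs_log_le_mul_rpow_neg (inv_pos.2 (mul_pos two_pos hq)) r
  have hd : 1 ≤ Module.finrank ℝ E := Module.finrank_pos
  rw [← integrable_norm_rpow_iff hmeas.aestronglyMeasurable hp0 hp]
  refine integrableOn_ball_of_norm_le_rpow (C := C ^ p.toReal) (α := 1 / 2) hd
    (one_half_lt_one.trans_le (by exact_mod_cast hd)) ?_
    (hmeas.norm.pow_const p.toReal).aestronglyMeasurable
  filter_upwards [ae_restrict_of_ae (Measure.ae_ne μ 0),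
    ae_restrict_mem Metric.isOpen_ball.measurableSet] with x hx hxr
  calc ‖‖Real.log ‖x‖‖ ^ p.toReal‖ ≤ (C * ‖x‖ ^ (-(2 * p.toReal)⁻¹)) ^ p.toReal := by
        rw [Real.norm_of_nonneg (by positivity), Real.norm_eq_abs]
        gcongr
        exact hC _ (norm_pos_iff.2 hx) (mem_ball_zero_iff.1 hxr).le
    _ = C ^ p.toReal * ‖x‖ ^ (-(1 / 2 : ℝ)) := by
        rw [Real.mul_rpow hC0 (by positivity), ← Real.rpow_mul (norm_nonneg x)]
        congr 2
        field_simp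

section Laplacian

variable {E : Type*} [NormedAddCommGroup E] [InnerProductSpace ℝ E]

theorem hasFDerivAt_comp_norm_sub_sq {H : ℝ → ℝ} {w ξ : E}
    (hH : DifferentiableAt ℝ H (‖ξ - w‖ ^ 2)) :
    HasFDerivAt (fun x => H (‖x - w‖ ^ 2)) ((2 * deriv H (‖ξ - w‖ ^ 2)) • innerSL ℝ (ξ - w)) ξ := by
  refine (hH.hasDerivAt.comp_hasFDerivAt ξ
    ((hasFDerivAt_id (𝕜 := ℝ) ξ).sub_const w).norm_sq).congr_fderiv ?_
  ext y
  simp only [smul_apply, ContinuousLinearMap.comp_apply, ContinuousLinearMap.id_apply, id_eq,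
    innerSL_apply_apply, smul_eq_mul, nsmul_eq_mul]
  ring

variable [FiniteDimensional ℝ E]

theorem continuous_laplacian {F : Type*} [NormedAddCommGroup F] [NormedSpace ℝ F] {f : E → F}
    (hf : ContDiff ℝ 2 f) : Continuous (Δ f) := by
  rw [InnerProductSpace.laplacian_eq_iteratedFDeriv_stdOrthonormalBasis]
  exact continuous_finsetSum _ fun i _ =>
    (ContinuousMultilinearMap.apply ℝ (fun _ : Fin 2 => E) F _).continuous.comp
      (hf.continuous_iteratedFDeriv le_rfl)

theorem laplacian_comp_norm_sub_sq {H : ℝ → ℝ} {w ξ : E}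
    (hH : ContDiffAt ℝ 2 H (‖ξ - w‖ ^ 2)) :
    (Δ fun x => H (‖x - w‖ ^ 2)) ξ = 4 * ‖ξ - w‖ ^ 2 * deriv (deriv H) (‖ξ - w‖ ^ 2) +
      2 * Module.finrank ℝ E * deriv H (‖ξ - w‖ ^ 2) := by
  have hH' : ContDiffAt ℝ 1 (deriv H) (‖ξ - w‖ ^ 2) := hH.derivWithin le_rfl
  have hcont : ContinuousAt (fun x : E => ‖x - w‖ ^ 2) ξ := by fun_prop
  have hfst : fderiv ℝ (fun x => H (‖x - w‖ ^ 2)) =ᶠ[𝓝 ξ]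
      fun x => (2 * deriv H (‖x - w‖ ^ 2)) • innerSL ℝ (x - w) := by
    filter_upwards [hcont.eventually (hH.eventually (by simp))] with x hx
    exact (hasFDerivAt_comp_norm_sub_sq (hx.differentiableAt two_ne_zero)).fderiv
  have hcoeff := (hasFDerivAt_comp_norm_sub_sq (hH'.differentiableAt one_ne_zero)).const_mul 2
  have hlin : HasFDerivAt (fun x : E => innerSL ℝ (x - w)) (innerSL ℝ : E →L[ℝ] E →L[ℝ] ℝ) ξ :=
    (innerSL ℝ : E →L[ℝ] E →L[ℝ] ℝ).hasFDerivAt.comp ξ ((hasFDerivAt_id (𝕜 := ℝ) ξ).sub_const w)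
  have hsnd (e : E) : fderiv ℝ (fderiv ℝ fun x => H (‖x - w‖ ^ 2)) ξ e e =
      4 * deriv (deriv H) (‖ξ - w‖ ^ 2) * inner ℝ e (ξ - w) ^ 2 +
        2 * deriv H (‖ξ - w‖ ^ 2) * ‖e‖ ^ 2 := by
    rw [hfst.fderiv_eq, (hcoeff.fun_smul hlin).fderiv]
    have hself : (innerSL ℝ : E →L[ℝ] E →L[ℝ] ℝ) e e = ‖e‖ ^ 2 := real_inner_self_eq_norm_sq e
    simp only [add_apply, smul_apply, ContinuousLinearMap.smulRight_apply, innerSL_apply_apply,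
      smul_eq_mul, real_inner_comm e (ξ - w), hself]
    ring
  simp only [InnerProductSpace.laplacian_eq_iteratedFDeriv_stdOrthonormalBasis,
    iteratedFDeriv_two_apply, Matrix.cons_val_zero, Matrix.cons_val_one, hsnd,
    Finset.sum_add_distrib, ← Finset.mul_sum, OrthonormalBasis.sum_sq_inner_right,
    OrthonormalBasis.norm_eq_one]
  simp only [one_pow, Finset.sum_const, Finset.card_univ, Fintype.card_fin, nsmul_eq_mul, mul_one]
  ring

end Laplacian

section BoundedLaplacian

variable {F : ℝ → ℝ} {b : ℝ}

theorem exists_abs_deriv_le_of_eqOn_log (hF : ContDiff ℝ 2 F) (hb : 0 < b)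
    (hlog : EqOn F Real.log (Ioi b)) :
    ∃ M, ∀ t, 0 ≤ t → |deriv F t| ≤ M ∧ |t * deriv (deriv F) t| ≤ M := by
  have hF' : ContDiff ℝ 1 (deriv F) := ContDiff.deriv' hF
  have hF'' : Continuous fun t => t * deriv (deriv F) t :=
    continuous_id.mul (hF'.continuous_deriv le_rfl)
  obtain ⟨M₁, hM₁⟩ := (isCompact_Icc (a := 0) (b := b)).exists_bound_of_continuousOn
    hF'.continuous.continuousOn
  obtain ⟨M₂, hM₂⟩ := (isCompact_Icc (a := 0) (b := b)).exists_bound_of_continuousOn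
    hF''.continuousOn
  have hd : EqOn (deriv F) (fun t => t⁻¹) (Ioi b) := fun t ht =>
    (hlog.deriv isOpen_Ioi ht).trans (Real.deriv_log t)
  have hdd (t : ℝ) (ht : b < t) : t * deriv (deriv F) t = -t⁻¹ := by
    have ht0 : t ≠ 0 := (hb.trans ht).ne'
    rw [hd.deriv isOpen_Ioi ht, deriv_inv]
    field_simp
  refine ⟨max b⁻¹ (max M₁ M₂), fun t ht => ?_⟩
  rcases le_or_gt t b with htb | htb
  · exact ⟨(hM₁ t ⟨ht, htb⟩).trans (by simp), (hM₂ t ⟨ht, htb⟩).trans (by simp)⟩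
  · have hinv : |t⁻¹| ≤ b⁻¹ := by
      rw [abs_of_pos (inv_pos.2 (hb.trans htb))]
      gcongr
    rw [hd htb, hdd t htb, abs_neg, and_self]
    exact hinv.trans (le_max_left _ _)

theorem exists_abs_laplacian_le_of_eqOn_log {E : Type*} [NormedAddCommGroup E]
    [InnerProductSpace ℝ E] [FiniteDimensional ℝ E] (hF : ContDiff ℝ 2 F) (hb : 0 < b)
    (hlog : EqOn F Real.log (Ioi b)) :
    ∃ M, ∀ w ξ : E, ∀ s, 0 ≤ s → |(Δ fun x : E => F (‖x - w‖ ^ 2 + s)) ξ| ≤ M := by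
  obtain ⟨M, hM⟩ := exists_abs_deriv_le_of_eqOn_log hF hb hlog
  refine ⟨4 * M + 2 * Module.finrank ℝ E * M, fun w ξ s hs => ?_⟩
  set q : ℝ := ‖ξ - w‖ ^ 2
  have hq : 0 ≤ q := by positivity
  obtain ⟨h₁, h₂⟩ := hM (q + s) (by positivity)
  have hFs : ContDiff ℝ 2 fun t => F (t + s) := hF.comp (contDiff_id.add contDiff_const)
  have hds : deriv (fun t => F (t + s)) = fun t => deriv F (t + s) :=
    funext fun t => deriv_comp_add_const F s t
  rw [laplacian_comp_norm_sub_sq hFs.contDiffAt, hds, deriv_comp_add_const]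
  calc |4 * q * deriv (deriv F) (q + s) + 2 * Module.finrank ℝ E * deriv F (q + s)|
      ≤ 4 * |q * deriv (deriv F) (q + s)| + 2 * Module.finrank ℝ E * |deriv F (q + s)| := by
        refine (abs_add_le _ _).trans_eq ?_
        rw [mul_assoc, abs_mul, abs_mul (2 * _), abs_of_pos four_pos,
          abs_of_nonneg (by positivity : (0 : ℝ) ≤ 2 * Module.finrank ℝ E)]
    _ ≤ 4 * |(q + s) * deriv (deriv F) (q + s)| +
          2 * Module.finrank ℝ E * |deriv F (q + s)| := by
        rw [abs_mul, abs_mul (q + s), abs_of_nonneg hq, abs_of_nonneg (add_nonneg hq hs)]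
        gcongr
        exact le_add_of_nonneg_right hs
    _ ≤ 4 * M + 2 * Module.finrank ℝ E * M := by gcongr

end BoundedLaplacian

/-- The Laplacian of `ξ ↦ (4π)⁻¹ log (‖ξ - w‖² + s)` on the plane, an approximate identity at `w`
as `s → 0⁺`. -/
noncomputable def approxDelta (s : ℝ) (w ξ : ℂ) : ℝ := s / (Real.pi * (‖ξ - w‖ ^ 2 + s) ^ 2)

section ApproxDelta

variable {s : ℝ} {w : ℂ}

theorem continuous_approxDelta (hs : 0 < s) : Continuous (approxDelta s w) :=
  continuous_const.div (by fun_prop) fun ξ => by positivity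

theorem laplacian_log_norm_sub_sq_add (hs : 0 < s) (ξ : ℂ) :
    (Δ fun x : ℂ => Real.log (‖x - w‖ ^ 2 + s)) ξ = 4 * Real.pi * approxDelta s w ξ := by
  have hpos : 0 < ‖ξ - w‖ ^ 2 + s := by positivity
  have hlog : ContDiffAt ℝ 2 (fun t => Real.log (t + s)) (‖ξ - w‖ ^ 2) :=
    (contDiffAt_id.add contDiffAt_const).log hpos.ne'
  have hd : deriv (fun t => Real.log (t + s)) = fun t => (t + s)⁻¹ := funext fun t => by
    rw [deriv_comp_add_const, Real.deriv_log]
  rw [laplacian_comp_norm_sub_sq hlog, hd, deriv_comp_add_const (f := fun t : ℝ => t⁻¹), deriv_inv,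
    Complex.finrank_real_complex, approxDelta]
  field_simp
  push_cast
  ring

theorem integral_approxDelta_one_zero : ∫ ξ, approxDelta 1 0 ξ = 1 := by
  have hderiv (y : ℝ) : HasDerivAt (fun y : ℝ => -(2 * Real.pi * (y ^ 2 + 1))⁻¹)
      (y * (1 / (Real.pi * (y ^ 2 + 1) ^ 2))) y := by
    refine ((((hasDerivAt_pow 2 y).add_const 1).const_mul (2 * Real.pi)).fun_inv
      (by positivity)).fun_neg.congr_deriv ?_
    field_simp
    simp
  have hlim : Tendsto (fun y : ℝ => -(2 * Real.pi * (y ^ 2 + 1))⁻¹) atTop (𝓝 (-0)) :=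
    (tendsto_inv_atTop_zero.comp ((tendsto_atTop_add_const_right _ 1
      (tendsto_pow_atTop two_ne_zero)).const_mul_atTop Real.two_pi_pos)).neg
  have hradial : ∫ y in Ioi (0 : ℝ), y * (1 / (Real.pi * (y ^ 2 + 1) ^ 2)) =
      (2 * Real.pi)⁻¹ := by
    rw [integral_Ioi_of_hasDerivAt_of_nonneg' (fun y _ => hderiv y) (fun y hy => ?_) hlim]
    · simp
    · have : (0 : ℝ) < y := hy
      positivity
  simp only [approxDelta, sub_zero]
  rw [integral_fun_norm_addHaar volume fun y : ℝ => 1 / (Real.pi * (y ^ 2 + 1) ^ 2),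
    Complex.finrank_real_complex]
  simp only [Nat.add_one_sub_one, pow_one, smul_eq_mul, hradial]
  simp [Measure.real]

theorem tendsto_norm_sq_mul_approxDelta_one_zero :
    Tendsto (fun ξ : ℂ => ‖ξ‖ ^ 2 * approxDelta 1 0 ξ) (Bornology.cobounded ℂ) (𝓝 0) := by
  have hlim : Tendsto (fun ξ : ℂ => (Real.pi * ‖ξ‖ ^ 2)⁻¹) (Bornology.cobounded ℂ) (𝓝 0) :=
    tendsto_inv_atTop_zero.comp (((tendsto_pow_atTop two_ne_zero).comp
      tendsto_norm_cobounded_atTop).const_mul_atTop Real.pi_pos)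
  refine squeeze_zero (fun ξ => by unfold approxDelta; positivity) (fun ξ => ?_) hlim
  rcases eq_or_ne ξ 0 with rfl | hξ
  · simp
  rw [approxDelta, sub_zero]
  calc ‖ξ‖ ^ 2 * (1 / (Real.pi * (‖ξ‖ ^ 2 + 1) ^ 2))
      ≤ ‖ξ‖ ^ 2 * (1 / (Real.pi * (‖ξ‖ ^ 2) ^ 2)) := by
        gcongr
        exact le_add_of_nonneg_right zero_le_one
    _ = (Real.pi * ‖ξ‖ ^ 2)⁻¹ := by field_simp

theorem tendsto_setIntegral_approxDelta_mul {D : Set ℂ} (hD : MeasurableSet D) (hw : D ∈ 𝓝 w)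
    {g : ℂ → ℝ} (hg : IntegrableOn g D) (hgw : ContinuousAt g w) :
    Tendsto (fun s => ∫ ξ in D, approxDelta s w ξ * g ξ) (𝓝[>] 0) (𝓝 (g w)) := by
  have hind : ContinuousAt (D.indicator g) w :=
    hgw.congr (eventually_of_mem hw fun x hx => (indicator_of_mem hx g).symm)
  have hscale : Tendsto (fun s : ℝ => (√s)⁻¹) (𝓝[>] 0) atTop := by
    refine tendsto_inv_nhdsGT_zero.comp (tendsto_nhdsWithin_iff.2 ⟨?_, ?_⟩)
    · simpa using (Real.continuous_sqrt.tendsto 0).mono_left nhdsWithin_le_nhds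
    · filter_upwards [self_mem_nhdsWithin] with s hs using Real.sqrt_pos.2 hs
  have hpeak := (tendsto_integral_comp_smul_smul_of_integrable' (μ := (volume : Measure ℂ))
    (fun ξ => by unfold approxDelta; positivity) integral_approxDelta_one_zero
    (by simpa only [Complex.finrank_real_complex] using tendsto_norm_sq_mul_approxDelta_one_zero)
    (hg.integrable_indicator hD) hind).comp hscale
  rw [indicator_of_mem (mem_of_mem_nhds hw)] at hpeak
  refine hpeak.congr' ?_
  filter_upwards [self_mem_nhdsWithin] with s (hs : 0 < s)
  rw [← integral_indicator hD, Function.comp_apply]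
  refine integral_congr_ae (.of_forall fun ξ => ?_)
  have hkernel : ((√s)⁻¹) ^ 2 * approxDelta 1 0 ((√s)⁻¹ • (w - ξ)) = approxDelta s w ξ := by
    rw [approxDelta, approxDelta, sub_zero, norm_smul, mul_pow, norm_inv, inv_pow, inv_pow,
      Real.norm_of_nonneg (Real.sqrt_nonneg s), Real.sq_sqrt hs.le, norm_sub_rev]
    field_simp
  simp only [Complex.finrank_real_complex, smul_eq_mul, hkernel, indicator_mul_right]

end ApproxDelta

/-- The logarithm with its singularity removed: it vanishes on `(-∞, b / 2]`, equals `log` on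
`[b, ∞)` and is smooth on the whole line for `0 < b`. -/
noncomputable def logTail (b t : ℝ) : ℝ :=
  Real.smoothTransition ((t - b / 2) / (b / 2)) * Real.log t

section LogTail

variable {b t : ℝ}

theorem logTail_of_le_half (hb : 0 < b) (ht : t ≤ b / 2) : logTail b t = 0 := by
  rw [logTail, Real.smoothTransition.zero_of_nonpos, zero_mul]
  exact div_nonpos_of_nonpos_of_nonneg (by linarith) (by positivity)

theorem logTail_of_ge (hb : 0 < b) (ht : b ≤ t) : logTail b t = Real.log t := by
  rw [logTail, Real.smoothTransition.one_of_one_le, one_mul]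
  rw [le_div_iff₀ (by positivity)]
  linarith

theorem contDiff_logTail (hb : 0 < b) : ContDiff ℝ ∞ (logTail b) := by
  refine contDiff_iff_contDiffAt.2 fun t => ?_
  rcases lt_or_ge t (b / 2) with ht | ht
  · refine (contDiffAt_const (c := (0 : ℝ))).congr_of_eventuallyEq ?_
    filter_upwards [Iio_mem_nhds ht] with x hx using logTail_of_le_half hb hx.le
  · have ht0 : t ≠ 0 := ((half_pos hb).trans_le ht).ne'
    exact (Real.smoothTransition.contDiffAt.comp t
      ((contDiffAt_id.sub contDiffAt_const).div_const _)).mul (Real.contDiffAt_log.2 ht0)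

theorem abs_log_sub_logTail_le (b t : ℝ) : |Real.log t - logTail b t| ≤ |Real.log t| := by
  have h₀ := Real.smoothTransition.nonneg ((t - b / 2) / (b / 2))
  have h₁ := Real.smoothTransition.le_one ((t - b / 2) / (b / 2))
  rw [logTail, ← one_sub_mul, abs_mul, abs_of_nonneg (sub_nonneg.2 h₁)]
  exact mul_le_of_le_one_left (abs_nonneg _) (by linarith)

end LogTail

/-- The regularized logarithm `ξ ↦ log (‖ξ - w‖² + s)`, cut off smoothly to be supported in the
closed disk of radius `r` about `w`: the test function for the equation `Δ g = δ_z`. -/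
noncomputable def cutoffLog (r : ℝ) (w : ℂ) (s : ℝ) (ξ : ℂ) : ℝ :=
  Real.log (‖ξ - w‖ ^ 2 + s) - logTail (r ^ 2) (‖ξ - w‖ ^ 2 + s)

section CutoffLog

variable {r s : ℝ} {w : ℂ}

theorem contDiff_cutoffLog (hr : 0 < r) (hs : 0 < s) : ContDiff ℝ ∞ (cutoffLog r w s) := by
  have hq : ContDiff ℝ ∞ fun ξ : ℂ => ‖ξ - w‖ ^ 2 + s :=
    ((contDiff_id.sub contDiff_const).norm_sq ℝ).add contDiff_const
  exact (hq.log fun ξ => by positivity).sub ((contDiff_logTail (by positivity)).comp hq)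

theorem tsupport_cutoffLog_subset (hr : 0 < r) (hs : 0 ≤ s) :
    tsupport (cutoffLog r w s) ⊆ Metric.closedBall w r := by
  refine closure_minimal (fun ξ hξ => ?_) Metric.isClosed_closedBall
  contrapose! hξ
  rw [Metric.mem_closedBall, dist_eq_norm, not_le] at hξ
  have hle : r ^ 2 ≤ ‖ξ - w‖ ^ 2 + s := by nlinarith
  rw [Function.notMem_support, cutoffLog, logTail_of_ge (by positivity) hle, sub_self]

theorem exists_abs_approxDelta_sub_laplacian_cutoffLog_le (hr : 0 < r) :
    ∃ M, ∀ w ξ : ℂ, ∀ s, 0 < s →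
      |4 * Real.pi * approxDelta s w ξ - (Δ (cutoffLog r w s)) ξ| ≤ M := by
  have hb : 0 < r ^ 2 := by positivity
  have htail : ContDiff ℝ 2 (logTail (r ^ 2)) := contDiff_infty.1 (contDiff_logTail hb) 2
  obtain ⟨M, hM⟩ := exists_abs_laplacian_le_of_eqOn_log (E := ℂ) htail hb
    fun t ht => logTail_of_ge hb (le_of_lt ht)
  refine ⟨M, fun w ξ s hs => ?_⟩
  have hq : ContDiff ℝ 2 fun x : ℂ => ‖x - w‖ ^ 2 + s :=
    ((contDiff_id.sub contDiff_const).norm_sq ℝ).add contDiff_const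
  have hsub : (Δ (cutoffLog r w s)) ξ = 4 * Real.pi * approxDelta s w ξ -
      (Δ fun x : ℂ => logTail (r ^ 2) (‖x - w‖ ^ 2 + s)) ξ := by
    rw [← laplacian_log_norm_sub_sq_add hs]
    exact (hq.log fun x => by positivity).contDiffAt.laplacian_sub (htail.comp hq).contDiffAt
  rw [hsub, sub_sub_cancel]
  exact hM w ξ s hs.le

end CutoffLog

namespace IsGreenFunction

variable {D : Set ℂ} {z : ℂ} {g : ℂ → ℝ}

theorem memLp_sdiff_ball (hg : IsGreenFunction D z g) (hDo : IsOpen D)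
    (hDb : Bornology.IsBounded D) {r : ℝ} (hr : 0 < r) (p : ENNReal) :
    MemLp g p (volume.restrict (D \ Metric.ball z r)) :=
  memLp_restrict_of_continuousOn (hDo.measurableSet.diff Metric.isOpen_ball.measurableSet)
    (hDb.isCompact_closure.diff Metric.isOpen_ball) (sdiff_subset_sdiff_left subset_closure)
    (hg.continuousOn.mono (sdiff_subset_sdiff_right
      (singleton_subset_iff.2 (Metric.mem_ball_self hr))))

theorem integrableOn (hg : IsGreenFunction D z g) (hDo : IsOpen D)
    (hDb : Bornology.IsBounded D) (hz : z ∈ D) : IntegrableOn g D := by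
  obtain ⟨r, hr, hrD⟩ := Metric.nhds_basis_closedBall.mem_iff.1 (hDo.mem_nhds hz)
  have hin : IntegrableOn g (Metric.closedBall z r) :=
    hg.locallyIntegrable.integrableOn_compact_subset hrD (isCompact_closedBall z r)
  have hout : IntegrableOn g (D \ Metric.ball z r) :=
    memLp_one_iff_integrable.1 (hg.memLp_sdiff_ball hDo hDb hr 1)
  refine ((hin.mono_set Metric.ball_subset_closedBall).union hout).mono_set ?_
  rw [union_sdiff_self]
  exact subset_union_right

theorem setIntegral_laplacian_cutoffLog_mul (hg : IsGreenFunction D z g) {w : ℂ} {r s : ℝ}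
    (hr : 0 < r) (hs : 0 < s) (hrD : Metric.closedBall w r ⊆ D) :
    ∫ ξ in D, (Δ (cutoffLog r w s)) ξ * g ξ = cutoffLog r w s z := by
  have hsupp : tsupport (cutoffLog r w s) ⊆ Metric.closedBall w r :=
    tsupport_cutoffLog_subset hr hs.le
  simp only [mul_comm _ (g _)]
  exact hg.laplacian_eq _ (contDiff_cutoffLog hr hs)
    ((isCompact_closedBall w r).of_isClosed_subset (isClosed_tsupport _) hsupp)
    (hsupp.trans hrD)

theorem exists_abs_setIntegral_approxDelta_mul_le (hg : IsGreenFunction D z g) (hDo : IsOpen D)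
    (hDb : Bornology.IsBounded D) (hz : z ∈ D) {r : ℝ} (hr : 0 < r) :
    ∃ C, ∀ w s, 0 < s → Metric.closedBall w r ⊆ D →
      4 * Real.pi * |∫ ξ in D, approxDelta s w ξ * g ξ| ≤ |Real.log (‖z - w‖ ^ 2 + s)| + C := by
  obtain ⟨M, hM⟩ := exists_abs_approxDelta_sub_laplacian_cutoffLog_le hr
  have hgi : IntegrableOn g D := hg.integrableOn hDo hDb hz
  refine ⟨M * ∫ ξ in D, |g ξ|, fun w s hs hrD => ?_⟩
  have hΔ : Continuous (Δ (cutoffLog r w s)) :=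
    continuous_laplacian (contDiff_infty.1 (contDiff_cutoffLog hr hs) 2)
  have hδ : Continuous fun ξ => 4 * Real.pi * approxDelta s w ξ :=
    continuous_const.mul (continuous_approxDelta hs)
  have hcomp := abs_integral_mul_le_abs_integral_mul_add (μ := volume.restrict D)
    hδ.aestronglyMeasurable hΔ.aestronglyMeasurable hgi
    (hgi.continuousOn_mul_of_subset hΔ.continuousOn hDb.isCompact_closure hDo.measurableSet
      subset_closure) (.of_forall fun ξ => hM w ξ s hs)
  simp only [mul_assoc (4 * Real.pi), integral_const_mul] at hcomp
  rw [abs_mul, abs_of_pos (by positivity : 0 < 4 * Real.pi),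
    hg.setIntegral_laplacian_cutoffLog_mul hr hs hrD] at hcomp
  exact hcomp.trans (add_le_add_left (abs_log_sub_logTail_le _ _) _)

theorem exists_abs_le_log_add (hg : IsGreenFunction D z g) (hDo : IsOpen D)
    (hDb : Bornology.IsBounded D) {r : ℝ} (hr : 0 < r) (hrD : Metric.closedBall z (2 * r) ⊆ D) :
    ∃ C, ∀ w ∈ Metric.ball z r, w ≠ z →
      4 * Real.pi * |g w| ≤ |Real.log (‖w - z‖ ^ 2)| + C := by
  have hz : z ∈ D := hrD (Metric.mem_closedBall_self (by positivity))
  obtain ⟨C, hC⟩ := hg.exists_abs_setIntegral_approxDelta_mul_le hDo hDb hz hr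
  refine ⟨C, fun w hw hwz => ?_⟩
  have hwD : Metric.closedBall w r ⊆ D :=
    (Metric.closedBall_subset_closedBall' (by linarith [Metric.mem_ball.1 hw])).trans hrD
  have hDw : D ∈ 𝓝 w := hDo.mem_nhds (hwD (Metric.mem_closedBall_self hr.le))
  have hgw : ContinuousAt g w := hg.continuousOn.continuousAt
    (inter_mem (mem_of_superset hDw subset_closure) (isOpen_ne.mem_nhds hwz))
  have hlog : Tendsto (fun s => |Real.log (‖z - w‖ ^ 2 + s)| + C) (𝓝[>] 0)
      (𝓝 (|Real.log (‖w - z‖ ^ 2)| + C)) := by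
    have hpos : ‖z - w‖ ^ 2 + 0 ≠ 0 := by simpa [sub_eq_zero] using hwz.symm
    have hcont : ContinuousAt (fun s => |Real.log (‖z - w‖ ^ 2 + s)| + C) 0 :=
      ((continuousAt_const.add continuousAt_id).log hpos).abs.add continuousAt_const
    simpa [norm_sub_rev] using hcont.tendsto.mono_left nhdsWithin_le_nhds
  refine le_of_tendsto_of_tendsto ((tendsto_setIntegral_approxDelta_mul hDo.measurableSet hDw
    (hg.integrableOn hDo hDb hz) hgw).abs.const_mul (4 * Real.pi)) hlog ?_
  filter_upwards [self_mem_nhdsWithin] with s hs using hC w s hs hwD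

theorem memLp (hg : IsGreenFunction D z g) (hDo : IsOpen D) (hDb : Bornology.IsBounded D)
    (hz : z ∈ D) {p : ENNReal} (hp : p ≠ ⊤) : MemLp g p (volume.restrict D) := by
  obtain ⟨R, hR, hRD⟩ := Metric.nhds_basis_closedBall.mem_iff.1 (hDo.mem_nhds hz)
  have hr : 0 < R / 2 := by positivity
  obtain ⟨C, hC⟩ := hg.exists_abs_le_log_add hDo hDb hr (by rwa [mul_div_cancel₀ _ two_ne_zero])
  have hrD : Metric.ball z (R / 2) ⊆ D :=
    (Metric.ball_subset_closedBall.trans (Metric.closedBall_subset_closedBall (by linarith))).trans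
      hRD
  have hin : MemLp g p (volume.restrict (Metric.ball z (R / 2))) := by
    have : IsFiniteMeasure (volume.restrict (Metric.ball z (R / 2))) :=
      isFiniteMeasure_restrict.2 measure_ball_lt_top.ne
    have hdom : MemLp (fun w => (4 * Real.pi)⁻¹ * (|2 * Real.log ‖w - z‖| + C)) p
        (volume.restrict (Metric.ball z (R / 2))) :=
      ((((memLp_log_norm_sub volume z _ hp).const_mul 2).abs).add (memLp_const C)).const_mul _
    refine hdom.mono' ((hg.integrableOn hDo hDb hz).mono_set hrD).aestronglyMeasurable ?_
    filter_upwards [ae_restrict_of_ae (Measure.ae_ne volume z),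
      ae_restrict_mem Metric.isOpen_ball.measurableSet] with w hwz hw
    rw [Real.norm_eq_abs, ← div_eq_inv_mul, le_div_iff₀' (by positivity)]
    simpa only [Real.log_pow, Nat.cast_ofNat] using hC w hw hwz
  have hunion := memLp_restrict_union Metric.isOpen_ball.measurableSet
    (hDo.measurableSet.diff Metric.isOpen_ball.measurableSet) hin (hg.memLp_sdiff_ball hDo hDb hr p)
  rwa [union_sdiff_cancel hrD] at hunion

end IsGreenFunction

theorem IsSmoothOnClosure.memLp {D : Set ℂ} {u : ℂ → ℝ} (hu : IsSmoothOnClosure D u)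
    (hDo : IsOpen D) (hDb : Bornology.IsBounded D) (p : ENNReal) :
    MemLp u p (volume.restrict D) := by
  obtain ⟨U, -, hDU, hu⟩ := hu
  exact memLp_restrict_of_continuousOn hDo.measurableSet hDb.isCompact_closure subset_closure
    (hu.continuousOn.mono hDU)

theorem abs_le_boundarySupNorm {D : Set ℂ} {f : frontier D → ℝ}
    (hf : ∃ M, ∀ ζ, |f ζ| ≤ M) (ζ : frontier D) : |f ζ| ≤ boundarySupNorm D f :=
  le_ciSup (f := fun ζ => |f ζ|) (hf.imp fun _ hM => forall_mem_range.2 hM) ζ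

theorem mainTheorem7_general {D : Set ℂ} (hDo : IsOpen D) (hDb : Bornology.IsBounded D)
    {u : ℂ → ℝ} (hu : MemLp u 2 (volume.restrict D)) {f : frontier D → ℝ}
    (hf : ∃ M, ∀ ζ, |f ζ| ≤ M) {z : ℂ} (hz : z ∈ D) {g : ℂ → ℝ} (hg : IsGreenFunction D z g) :
    MemLp g 2 (volume.restrict D) ∧
      IntegrableOn (fun ξ => u ξ * dirichletSolution D f ξ * g ξ) D ∧
      |firstOrderTerm D u f g| ≤ l2Norm D u * l2Norm D g * boundarySupNorm D f := by
  have hg2 : MemLp g 2 (volume.restrict D) := hg.memLp hDo hDb hz ENNReal.ofNat_ne_top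
  have hfabove : BddAbove (range f) :=
    hf.imp fun _ hM => forall_mem_range.2 fun ζ => (le_abs_self _).trans (hM ζ)
  have hφ : AEStronglyMeasurable (dirichletSolution D f) (volume.restrict D) :=
    (aemeasurable_restrict_of_lowerSemicontinuousOn hDo.measurableSet
      (lowerSemicontinuousOn_dirichletSolution hDo hDb hfabove)).aestronglyMeasurable
  have hφ_le : ∀ᵐ ξ ∂volume.restrict D, |dirichletSolution D f ξ| ≤ boundarySupNorm D f :=
    ae_restrict_of_forall_mem hDo.measurableSet fun _ hξ =>
      abs_dirichletSolution_le hDo hDb (abs_le_boundarySupNorm hf) hξ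
  exact ⟨hg2, integrable_mul_mul_of_bound hu hφ hφ_le hg2, abs_integral_mul_mul_le_of_bound hu
    (Real.iSup_nonneg fun _ => abs_nonneg _) hφ_le hg2⟩

theorem mainTheorem7 (D : Set ℂ) (hD : IsBoundedC1Domain D)
    (u : ℂ → ℝ) (hu : IsSmoothOnClosure D u) (hu_nonneg : ∀ ξ ∈ D, 0 ≤ u ξ)
    (f : frontier D → ℝ) (hf : Measurable f) (hf_bdd : ∃ M : ℝ, ∀ ζ, |f ζ| ≤ M)
    (z : ℂ) (hz : z ∈ D) (g : ℂ → ℝ) (hg : IsGreenFunction D z g) :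
    MemLp u 2 (volume.restrict D) ∧ MemLp g 2 (volume.restrict D) ∧
      IntegrableOn (fun ξ => u ξ * dirichletSolution D f ξ * g ξ) D ∧
      |firstOrderTerm D u f g| ≤ l2Norm D u * l2Norm D g * boundarySupNorm D f := by
  have hu2 := hu.memLp hD.isOpen hD.isBounded 2
  exact ⟨hu2, mainTheorem7_general hD.isOpen hD.isBounded hu2 hf_bdd hz hg⟩
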